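/- Let $n\ge 0$ and let $C\subset\mathbb R^n$ be a polytope that is combinatorially equivalent to the $n$-dimensional cube $[0,1]^n$ (that is, the face lattices of $C$ and $[0,1]^n$ are isomorphic). Call $c\in\mathbb R^n$ nondegenerate if no two vertices of $C$ have the same value of $\langle c,\cdot\rangle$; for such $c$, orient every edge of $C$ towards its endpoint with smaller value of $\langle c,\cdot\rangle$. For a vertex $x$ consider the minimal number of edges of a directed path from $x$ to the vertex minimizing $\langle c,\cdot\rangle$. The monotone diameter $\text{mono-diam}(C)$ is the maximum of this number over all vertices $x$ and all nondegenerate $c$. Then $$\text{mono-diam}(C)=n .$$ Furthermore, $C$ has exactly $2n$ facets, and for every $c\in\mathbb R^n$ there is an ordering $F_1,\dots,F_{2n}$ of the facets of $C$ such that the following holds. Let $\langle a_i,x\rangle\le b_i$ be any valid inequality for $C$ that is tight on $C$ exactly at the points of $F_i$ ($1\le i\le 2n$), and consider the linear program of minimizing $\langle c,x\rangle$ subject to $\langle a_i,x\rangle+s_i=b_i$, $s_i\ge 0$. Then from every vertex of $C$ the simplex method with Bland's rule (the entering variable is the nonbasic slack variable $s_i$ of smallest index with negative reduced cost; the leaving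 variable is the one of smallest index attaining the minimum ratio) can be started, and it reaches an optimal solution after at most $n$ pivots. -/

import Mathlib

/-- Euclidean `n`-space. -/
abbrev Euc (n : ℕ) : Type := EuclideanSpace ℝ (Fin n)

/-- A (convex) polytope: the convex hull of finitely many points. -/
def IsPolytope {n : ℕ} (C : Set (Euc n)) : Prop :=
  ∃ s : Set (Euc n), s.Finite ∧ C = convexHull ℝ s

/-- The faces of `C`, ordered by inclusion: the empty set and all sets of maximizers over `C` of
a linear functional (the zero functional gives `C` itself). -/
abbrev Face {n : ℕ} (C : Set (Euc n)) : Type := {F : Set (Euc n) // IsExposed ℝ C F}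

/-- The standard cube `[0,1]ⁿ`. -/
def unitCube (n : ℕ) : Set (Euc n) := {x | ∀ i, 0 ≤ x i ∧ x i ≤ 1}

/-- Combinatorial equivalence: the face lattices are isomorphic. -/
def CombinatoriallyEquivalent {n m : ℕ} (C : Set (Euc n)) (D : Set (Euc m)) : Prop :=
  Nonempty (Face C ≃o Face D)

/-- Vertices are the points `x` such that `{x}` is a face. -/
def vertices {n : ℕ} (C : Set (Euc n)) : Set (Euc n) := {x | IsExposed ℝ C {x}}

/-- Two distinct vertices span an edge if the segment between them is a face. -/
def IsEdge {n : ℕ} (C : Set (Euc n)) (x y : Euc n) : Prop :=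
  x ∈ vertices C ∧ y ∈ vertices C ∧ x ≠ y ∧ IsExposed ℝ C (segment ℝ x y)

/-- Facets: the (nonempty) maximal proper faces. -/
def IsFacet {n : ℕ} (C F : Set (Euc n)) : Prop :=
  IsExposed ℝ C F ∧ F.Nonempty ∧ F ≠ C ∧
    ∀ G : Set (Euc n), IsExposed ℝ C G → F ⊆ G → G ≠ C → G = F

/-- `x` is an optimal solution of the problem of minimizing `⟨c, ·⟩` over `C`. -/
def IsOptimal {n : ℕ} (C : Set (Euc n)) (c x : Euc n) : Prop :=
  x ∈ C ∧ ∀ z ∈ C, inner ℝ c x ≤ inner ℝ c z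

/-- `c` is a nondegenerate objective: no two vertices have the same objective value. -/
def NondegenerateObjective {n : ℕ} (C : Set (Euc n)) (c : Euc n) : Prop :=
  Set.InjOn (fun x => inner ℝ c x) (vertices C)

/-- `MonotonePath C c k x y`: there is a directed path with `k` edges from the vertex `x` to the
vertex `y` in the graph of `C`, all edges being oriented towards the smaller objective value. -/
inductive MonotonePath {n : ℕ} (C : Set (Euc n)) (c : Euc n) : ℕ → Euc n → Euc n → Prop
  | nil (x : Euc n) (hx : x ∈ vertices C) : MonotonePath C c 0 x x
  | cons (k : ℕ) (x y z : Euc n) (hxy : IsEdge C x y) (hlt : inner ℝ c y < inner ℝ c x)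
      (hyz : MonotonePath C c k y z) : MonotonePath C c (k + 1) x z

/-- The length of a shortest `c`-monotone path from `x` to an optimal vertex (`⊤` if none). -/
noncomputable def monotoneDist {n : ℕ} (C : Set (Euc n)) (c x : Euc n) : ℕ∞ :=
  ⨅ (k : ℕ) (_ : ∃ y, IsOptimal C c y ∧ MonotonePath C c k x y), (k : ℕ∞)

/-- The `c`-monotone diameter: the maximum of `monotoneDist` over all starting vertices. -/
noncomputable def objMonotoneDiameter {n : ℕ} (C : Set (Euc n)) (c : Euc n) : ℕ∞ :=
  ⨆ x ∈ vertices C, monotoneDist C c x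

/-- The monotone diameter: the maximum over all nondegenerate objectives. -/
noncomputable def monotoneDiameter {n : ℕ} (C : Set (Euc n)) : ℕ∞ :=
  ⨆ (c : Euc n) (_ : NondegenerateObjective C c), objMonotoneDiameter C c

/-- `⟨a i, x⟩ ≤ b i` is a valid inequality for `C` that is tight exactly on the facet `F i`, for
every facet `F i` of an enumeration of the facets. -/
def IsFacetDescription {n : ℕ} {ι : Type*} (C : Set (Euc n)) (F : ι → Set (Euc n))
    (a : ι → Euc n) (b : ι → ℝ) : Prop :=
  ∀ i, (∀ x ∈ C, inner ℝ (a i) x ≤ b i) ∧ F i = {x ∈ C | inner ℝ (a i) x = b i}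

/-- A state of the simplex method for the linear program with constraints `⟨a i, x⟩ + s i = b i`,
`s i ≥ 0`: the current solution `x` and the index set of the nonbasic slack variables. -/
structure SimplexState (n : ℕ) (ι : Type*) where
  point : Euc n
  nonbasic : Finset ι

/-- `S` is a basic solution: the nonbasic slack variables vanish at the current point, and the
corresponding constraint normals form a basis of `ℝⁿ`. -/
def SimplexState.IsBasic {n : ℕ} {ι : Type*} (a : ι → Euc n) (b : ι → ℝ)
    (S : SimplexState n ι) : Prop :=
  (∀ i ∈ S.nonbasic, inner ℝ (a i) S.point = b i) ∧ S.nonbasic.card = n ∧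
    LinearIndependent ℝ (fun i : S.nonbasic => a i)

/-- `d` is the velocity of the point when the nonbasic slack variable `s i` is increased at unit
rate while the other nonbasic slack variables stay zero. For such `d`, the reduced cost of `s i`
is `⟨c, d⟩`. -/
def IsPivotDirection {n : ℕ} {ι : Type*} (a : ι → Euc n) (N : Finset ι) (i : ι) (d : Euc n) :
    Prop :=
  i ∈ N ∧ inner ℝ (a i) d = -1 ∧ ∀ j ∈ N, j ≠ i → inner ℝ (a j) d = 0

/-- `s j` is the leaving variable, and `t` the step length, that the minimum ratio test with
smallest-index tie breaking yields for movement from `x` in direction `d`. -/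
def IsLeaving {n : ℕ} {ι : Type*} [LinearOrder ι] (a : ι → Euc n) (b : ι → ℝ) (x d : Euc n)
    (j : ι) (t : ℝ) : Prop :=
  0 < inner ℝ (a j) d ∧ t = (b j - inner ℝ (a j) x) / inner ℝ (a j) d ∧
    ∀ k, 0 < inner ℝ (a k) d →
      t ≤ (b k - inner ℝ (a k) x) / inner ℝ (a k) d ∧
      (t = (b k - inner ℝ (a k) x) / inner ℝ (a k) d → j ≤ k)

/-- One pivot by Bland's rule for minimizing `⟨c, ·⟩`: the entering variable is the nonbasic
variable of smallest index with negative reduced cost; the leaving variable is the one of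
smallest index among those attaining the minimum ratio. -/
def BlandStep {n : ℕ} {ι : Type*} [LinearOrder ι] (a : ι → Euc n) (b : ι → ℝ) (c : Euc n)
    (S T : SimplexState n ι) : Prop :=
  ∃ (i j : ι) (d : Euc n) (t : ℝ),
    IsPivotDirection a S.nonbasic i d ∧ inner ℝ c d < 0 ∧
    (∀ (i' : ι) (d' : Euc n), IsPivotDirection a S.nonbasic i' d' → inner ℝ c d' < 0 → i ≤ i') ∧
    IsLeaving a b S.point d j t ∧
    T.point = S.point + t • d ∧ T.nonbasic = insert j (S.nonbasic.erase i)

/-- A run of the simplex method with Bland's rule, started at a basic solution; the run stays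
where it is once no pivot is possible. -/
def IsBlandRun {n : ℕ} {ι : Type*} [LinearOrder ι] (a : ι → Euc n) (b : ι → ℝ) (c : Euc n)
    (S : ℕ → SimplexState n ι) : Prop :=
  (S 0).IsBasic a b ∧
    ∀ k, BlandStep a b c (S k) (S (k + 1)) ∨
      ((∀ T, ¬ BlandStep a b c (S k) T) ∧ S (k + 1) = S k)

/-! The face lattice isomorphism labels vertices by `v : Fin n → Bool` and facets by pairs `(i, s)`,
with `X v` on the facet `(i, s)` exactly when `v i = s` (`IsCubeLabeling`). That a cube vertex
corresponds to a single point of `C` is a dimension count: a chain of faces in which `n` strict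
inclusions lead from it up to `C` must fit into `ℝⁿ`.

At `X v` the `n` tight facet normals are a basis, and the vectors to the vertices with one label
coordinate flipped are its dual basis up to negative factors. Hence every `y ∈ C` is `X v` plus a
nonnegative combination of these edge vectors, where the coefficient in coordinate `i` vanishes
exactly if `y` lies on the facet `(i, v i)`. If `y = X w` is better than `X v`, some edge vector
with nonzero coefficient must be improving, and following it corrects a coordinate in which `v` and
`w` differ (`exists_improving`). So an optimal vertex is reached within the Hamming distance, at
most `n`. Conversely an edge changes only one coordinate (`eq_flipAt_of_isExposed_segment`), so for
a generic objective the antipode of the optimum needs `n` steps.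

For Bland's rule, list the facets that miss an optimal vertex `X w` before those that contain it. A
pivot at a vertex follows an edge, with no ties in the ratio test (`blandStep_stateAt_iff`). At a
nonoptimal vertex some improving edge leaves a facet missing `X w`, so the smallest-index choice
also leaves such a facet, and each pivot lowers the Hamming distance to `w`. -/

/-- The vertex with one coordinate changed. -/
def flipAt {n : ℕ} (v : Fin n → Bool) (i : Fin n) : Fin n → Bool := Function.update v i (!v i)

@[simp] theorem flipAt_self {n : ℕ} (v : Fin n → Bool) (i : Fin n) : flipAt v i i = !v i := by
  simp [flipAt]

theorem flipAt_of_ne {n : ℕ} (v : Fin n → Bool) {i j : Fin n} (h : j ≠ i) :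
    flipAt v i j = v j := by
  simp [flipAt, h]

/-- `X` labels the vertices and `F` the facets of `C` like those of the `n`-cube. -/
structure IsCubeLabeling {n : ℕ} (C : Set (Euc n)) (X : (Fin n → Bool) → Euc n)
    (F : Fin n → Bool → Set (Euc n)) : Prop where
  isFacet : ∀ i s, IsFacet C (F i s)
  exists_eq_facet : ∀ G, IsFacet C G → ∃ i s, G = F i s
  mem_vertices : ∀ v, X v ∈ vertices C
  exists_mem : ∀ G : Set (Euc n), IsExposed ℝ C G → G.Nonempty → ∃ v, X v ∈ G
  mem_facet_iff : ∀ v i s, X v ∈ F i s ↔ v i = s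

/-! ### Exposed faces and their dimension -/

/-- If finitely many valid inequalities are simultaneously tight at some point of `C`, the points
where all of them are tight form an exposed face. -/
theorem isExposed_of_tight {n : ℕ} {ι : Type*} {C : Set (Euc n)} (s : Finset ι) (a : ι → Euc n)
    (b : ι → ℝ) (hle : ∀ i ∈ s, ∀ x ∈ C, inner ℝ (a i) x ≤ b i) {x₀ : Euc n} (hx₀ : x₀ ∈ C)
    (htight : ∀ i ∈ s, inner ℝ (a i) x₀ = b i) :
    IsExposed ℝ C {x ∈ C | ∀ i ∈ s, inner ℝ (a i) x = b i} := by
  intro _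
  -- The sum of the normals is maximal exactly where all inequalities are tight, because they are
  -- tight together at `x₀`.
  refine ⟨innerSL ℝ (∑ i ∈ s, a i), ?_⟩
  have key : ∀ x, innerSL ℝ (∑ i ∈ s, a i) x = ∑ i ∈ s, inner ℝ (a i) x := fun x => by
    simp
  ext x
  simp only [key, Set.mem_ofPred_eq]
  refine and_congr_right fun hx => ⟨fun h y hy => ?_, fun h => ?_⟩
  · exact Finset.sum_le_sum fun i hi => (h i hi).symm ▸ hle i hi y hy
  · have h1 := h x₀ hx₀
    rw [Finset.sum_congr rfl htight] at h1
    exact (Finset.sum_eq_sum_iff_of_le fun i hi => hle i hi x hx).1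
      (le_antisymm (Finset.sum_le_sum fun i hi => hle i hi x hx) h1)

/-- The dimension of faces grows strictly. -/
theorem finrank_vectorSpan_lt_of_ssubset {n : ℕ} {C F G : Set (Euc n)} (hF : IsExposed ℝ C F)
    (hne : F.Nonempty) (hGC : G ⊆ C) (h : F ⊂ G) :
    Module.finrank ℝ (vectorSpan ℝ F) < Module.finrank ℝ (vectorSpan ℝ G) := by
  apply Submodule.finrank_lt_finrank_of_lt
  refine lt_of_le_of_ne (vectorSpan_mono ℝ h.subset) fun heq => ?_
  obtain ⟨y, hyG, hyF⟩ := Set.exists_of_ssubset h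
  obtain ⟨x, hx⟩ := hne
  obtain ⟨l, hl⟩ := hF ⟨x, hx⟩
  have hker : vectorSpan ℝ F ≤ LinearMap.ker l.toLinearMap := by
    refine Submodule.span_le.2 ?_
    rintro _ ⟨p, hp, q, hq, rfl⟩
    rw [hl] at hp hq
    have := le_antisymm (hp.2 q hq.1) (hq.2 p hp.1)
    simp [this]
  have hmem : y -ᵥ x ∈ vectorSpan ℝ F := heq ▸ vsub_mem_vectorSpan ℝ hyG (h.subset hx)
  have h0 := hker hmem
  have hxy : l y = l x := by simpa [sub_eq_zero] using h0
  apply hyF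
  rw [hl] at hx ⊢
  exact ⟨hGC hyG, fun z hz => hxy ▸ hx.2 z hz⟩

/-! ### Faces of the standard cube -/

/-- The vertex of the standard cube with the given coordinates. -/
def cubeVertex {n : ℕ} (v : Fin n → Bool) : Euc n := WithLp.toLp 2 fun i => if v i then 1 else 0

@[simp] theorem cubeVertex_apply {n : ℕ} (v : Fin n → Bool) (i : Fin n) :
    cubeVertex v i = if v i then 1 else 0 := rfl

theorem cubeVertex_mem {n : ℕ} (v : Fin n → Bool) : cubeVertex v ∈ unitCube n := fun i => by
  cases h : v i <;> simp [h]

/-- The face of the standard cube on which the coordinates in `s` agree with those of `v`. -/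
def cubeFace {n : ℕ} (s : Finset (Fin n)) (v : Fin n → Bool) : Set (Euc n) :=
  {x ∈ unitCube n | ∀ i ∈ s, x i = if v i then 1 else 0}

theorem isExposed_cubeFace {n : ℕ} (s : Finset (Fin n)) (v : Fin n → Bool) :
    IsExposed ℝ (unitCube n) (cubeFace s v) := by
  have key : ∀ (i : Fin n) (x : Euc n),
      inner ℝ (EuclideanSpace.single i (if v i then (1 : ℝ) else -1)) x =
        if v i then x i else -x i := fun i x => by
    rw [EuclideanSpace.inner_single_left]
    split_ifs <;> simp
  have h := isExposed_of_tight s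
    (fun i => EuclideanSpace.single i (if v i then (1 : ℝ) else -1))
    (fun i => if v i then 1 else 0) (fun i _ x hx => by
      rw [key]
      have := hx i
      split_ifs <;> linarith) (cubeVertex_mem v) (fun i _ => by
      rw [key]; cases h : v i <;> simp [h])
  convert h using 1
  ext x
  refine and_congr_right fun _ => forall₂_congr fun i _ => ?_
  rw [key]
  cases v i <;> simp

theorem cubeVertex_mem_cubeFace {n : ℕ} {s : Finset (Fin n)} {v w : Fin n → Bool} :
    cubeVertex w ∈ cubeFace s v ↔ ∀ i ∈ s, w i = v i := by
  refine ⟨fun h i hi => ?_, fun h => ⟨cubeVertex_mem w, fun i hi => by simp [h i hi]⟩⟩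
  have := h.2 i hi
  cases h1 : w i <;> cases h2 : v i <;> simp [h1, h2] at this ⊢

theorem cubeFace_univ {n : ℕ} (v : Fin n → Bool) :
    cubeFace Finset.univ v = {cubeVertex v} := by
  ext x
  refine ⟨fun h => ?_, ?_⟩
  · ext i
    exact h.2 i (Finset.mem_univ i)
  · rintro rfl
    exact cubeVertex_mem_cubeFace.2 fun _ _ => rfl

theorem cubeFace_ssubset {n : ℕ} {s t : Finset (Fin n)} (v : Fin n → Bool) (h : t ⊂ s) :
    cubeFace s v ⊂ cubeFace t v := by
  obtain ⟨i, his, hit⟩ := Finset.exists_of_ssubset h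
  have hsub : cubeFace s v ⊆ cubeFace t v := fun x hx => ⟨hx.1, fun j hj => hx.2 j (h.1 hj)⟩
  refine (Set.ssubset_iff_of_subset hsub).2 ⟨cubeVertex (flipAt v i), ?_, ?_⟩
  · exact cubeVertex_mem_cubeFace.2 fun j hj =>
      flipAt_of_ne v (ne_of_mem_of_not_mem hj hit)
  · intro hc
    simpa using cubeVertex_mem_cubeFace.1 hc i his

/-- Changing one coordinate of a point of the standard cube. -/
theorem add_single_mem_unitCube {n : ℕ} {y : Euc n} (hy : y ∈ unitCube n) (i : Fin n) {r : ℝ}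
    (h0 : 0 ≤ r) (h1 : r ≤ 1) : y + (r - y i) • EuclideanSpace.single i (1 : ℝ) ∈ unitCube n := by
  intro j
  by_cases h : j = i
  · subst h
    simp [h0, h1]
  · simpa [h] using hy j

/-- Every nonempty face of the standard cube is the whole cube or lies in a facet. -/
theorem subset_cubeFace_singleton_of_ne {n : ℕ} {G : Set (Euc n)}
    (hG : IsExposed ℝ (unitCube n) G) (hne : G.Nonempty) (h : G ≠ unitCube n) :
    ∃ i v, G ⊆ cubeFace {i} v := by
  obtain ⟨l, hl⟩ := hG hne
  by_cases h0 : ∀ i, l (EuclideanSpace.single i 1) = 0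
  · refine absurd ?_ h
    have hl0 : ∀ x, l x = 0 := fun x => by
      have : l.toLinearMap = 0 :=
        (EuclideanSpace.basisFun (Fin n) ℝ).toBasis.ext fun i => by simpa using h0 i
      exact LinearMap.congr_fun this x
    rw [hl]
    ext x
    simp [hl0]
  · push Not at h0
    obtain ⟨i, hi⟩ := h0
    -- A nonzero coefficient of `l` forces coordinate `i` of every maximizer to the end given by its
    -- sign.
    refine ⟨i, fun _ => decide (0 < l (EuclideanSpace.single i 1)), fun y hy => ?_⟩
    rw [hl] at hy
    refine ⟨hy.1, fun j hj => ?_⟩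
    obtain rfl := Finset.mem_singleton.1 hj
    have hb := hy.1 j
    rcases lt_or_gt_of_ne hi with hlt | hlt
    · have := hy.2 _ (add_single_mem_unitCube hy.1 j le_rfl zero_le_one)
      rw [map_add, map_smul, smul_eq_mul] at this
      simp only [hlt.not_gt, decide_false]
      simp only [Bool.false_eq_true, if_false]
      nlinarith
    · have := hy.2 _ (add_single_mem_unitCube hy.1 j zero_le_one le_rfl)
      rw [map_add, map_smul, smul_eq_mul] at this
      simp only [hlt, decide_true, if_true]
      nlinarith

/-- Every nonempty face of the standard cube contains a vertex. -/
theorem exists_cubeVertex_mem {n : ℕ} {G : Set (Euc n)}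
    (hG : IsExposed ℝ (unitCube n) G) (hne : G.Nonempty) : ∃ v, cubeVertex v ∈ G := by
  obtain ⟨l, hl⟩ := hG hne
  have hsum : ∀ x : Euc n, l x = ∑ i, x i * l (EuclideanSpace.single i 1) := fun x => by
    conv_lhs => rw [← (EuclideanSpace.basisFun (Fin n) ℝ).sum_repr x]
    simp
  refine ⟨fun i => decide (0 < l (EuclideanSpace.single i 1)), ?_⟩
  rw [hl]
  refine ⟨cubeVertex_mem _, fun y hy => ?_⟩
  rw [hsum, hsum]
  refine Finset.sum_le_sum fun i _ => ?_
  have := hy i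
  rw [cubeVertex_apply]
  by_cases h : 0 < l (EuclideanSpace.single i 1)
  · simp only [h, decide_true, if_true]
    nlinarith
  · simp only [h, decide_false, Bool.false_eq_true, if_false]
    nlinarith

/-- Facets are told apart by their vertices: if `i ≠ j`, flipping coordinate `j` stays in the first
facet but leaves the second. -/
theorem cubeFace_singleton_subset {n : ℕ} {i j : Fin n} {v w : Fin n → Bool}
    (h : cubeFace {i} v ⊆ cubeFace {j} w) : i = j ∧ v i = w j := by
  have key : ∀ u : Fin n → Bool, u i = v i → u j = w j := fun u hu => by
    have := h (cubeVertex_mem_cubeFace.2 fun k hk => (Finset.mem_singleton.1 hk).symm ▸ hu)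
    exact cubeVertex_mem_cubeFace.1 this j (Finset.mem_singleton_self j)
  have hij : i = j := by
    by_contra hij
    have h1 := key v rfl
    have h2 := key (flipAt v j) (flipAt_of_ne v hij)
    simp [h1] at h2
  exact ⟨hij, by rw [← key v rfl, hij]⟩

theorem isFacet_cubeFace_singleton {n : ℕ} (i : Fin n) (v : Fin n → Bool) :
    IsFacet (unitCube n) (cubeFace {i} v) := by
  refine ⟨isExposed_cubeFace _ _, ⟨cubeVertex v, cubeVertex_mem_cubeFace.2 fun _ _ => rfl⟩,
    fun h => ?_, fun G hG hsub hne => ?_⟩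
  · have := cubeVertex_mem_cubeFace.1 (h.symm ▸ cubeVertex_mem (flipAt v i)) i
      (Finset.mem_singleton_self i)
    simp at this
  · have hGne : G.Nonempty := ⟨cubeVertex v, hsub (cubeVertex_mem_cubeFace.2 fun _ _ => rfl)⟩
    obtain ⟨j, w, hjw⟩ := subset_cubeFace_singleton_of_ne hG hGne hne
    obtain ⟨rfl, hvw⟩ := cubeFace_singleton_subset (hsub.trans hjw)
    refine hsub.antisymm' fun x hx => ?_
    have := hjw hx
    simpa [cubeFace, hvw] using this

theorem exists_eq_cubeFace_of_isFacet {n : ℕ} {G : Set (Euc n)} (hG : IsFacet (unitCube n) G) :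
    ∃ i v, G = cubeFace {i} v := by
  obtain ⟨i, v, h⟩ := subset_cubeFace_singleton_of_ne hG.1 hG.2.1 hG.2.2.1
  exact ⟨i, v, (hG.2.2.2 _ (isExposed_cubeFace _ _) h (isFacet_cubeFace_singleton i v).2.2.1).symm⟩

/-! ### Transfer along an isomorphism of face lattices -/

/-- The empty face is the least element of the lattice. -/
theorem Face.nonempty_map {n m : ℕ} {C : Set (Euc n)} {D : Set (Euc m)} (φ : Face C ≃o Face D)
    {G : Face C} (hG : (G : Set (Euc n)).Nonempty) : (φ G : Set (Euc m)).Nonempty := by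
  by_contra h
  rw [Set.not_nonempty_iff_eq_empty] at h
  have h1 : φ G ≤ φ ⟨∅, isExposed_empty⟩ := by
    rw [← Subtype.coe_le_coe, h]
    exact Set.empty_subset _
  obtain ⟨x, hx⟩ := hG
  exact (φ.le_iff_le.1 h1) hx

/-- The polytope itself is the greatest element of the lattice. -/
theorem Face.map_ne_self {n m : ℕ} {C : Set (Euc n)} {D : Set (Euc m)} (φ : Face C ≃o Face D)
    {G : Face C} (hG : (G : Set (Euc n)) ≠ C) : (φ G : Set (Euc m)) ≠ D := by
  intro h
  have h1 : φ ⟨C, IsExposed.refl C⟩ ≤ φ G := by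
    rw [← Subtype.coe_le_coe, h]
    exact (φ _).2.subset
  exact hG (G.2.subset.antisymm (φ.le_iff_le.1 h1))

theorem IsFacet.map {n m : ℕ} {C : Set (Euc n)} {D : Set (Euc m)} (φ : Face C ≃o Face D)
    {G : Face C} (hG : IsFacet C G) : IsFacet D (φ G) := by
  refine ⟨(φ G).2, Face.nonempty_map φ hG.2.1, Face.map_ne_self φ hG.2.2.1, fun H hH hle hne => ?_⟩
  have h1 : G ≤ φ.symm ⟨H, hH⟩ := by
    rw [OrderIso.le_symm_apply]
    exact hle
  have h2 := hG.2.2.2 _ (φ.symm ⟨H, hH⟩).2 h1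
    (Face.map_ne_self φ.symm (G := ⟨H, hH⟩) hne)
  have h3 : φ.symm ⟨H, hH⟩ = G := Subtype.ext h2
  rw [← h3, OrderIso.apply_symm_apply]

/-- The face corresponding to a vertex of the cube is a point, since the dimension grows strictly
along a maximal chain of faces above it. -/
theorem exists_symm_cubeVertex {n : ℕ} {C : Set (Euc n)} (φ : Face C ≃o Face (unitCube n))
    (v : Fin n → Bool) :
    ∃ x, (φ.symm ⟨cubeFace Finset.univ v, isExposed_cubeFace _ _⟩ : Set (Euc n)) = {x} := by
  have hne : ∀ s, (φ.symm ⟨cubeFace s v, isExposed_cubeFace _ _⟩ : Set (Euc n)).Nonempty :=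
    fun s => Face.nonempty_map φ.symm (G := ⟨cubeFace s v, isExposed_cubeFace _ _⟩)
      ⟨cubeVertex v, cubeVertex_mem_cubeFace.2 fun _ _ => rfl⟩
  let K : Finset (Fin n) → ℕ := fun s => Module.finrank ℝ (vectorSpan ℝ
    (φ.symm ⟨cubeFace s v, isExposed_cubeFace _ _⟩ : Set (Euc n)))
  -- Each coordinate released from the constraints enlarges the face and raises the dimension by at
  -- least one. Releasing all `n` of them leaves dimension 0 for the initial face.
  have key : ∀ s : Finset (Fin n), K Finset.univ + s.card ≤ K sᶜ := by
    intro s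
    induction s using Finset.induction_on with
    | empty => rw [Finset.card_empty, add_zero, Finset.compl_empty]
    | insert i s hi ih =>
      rw [Finset.card_insert_of_notMem hi, ← add_assoc]
      refine Nat.succ_le_of_lt (ih.trans_lt ?_)
      refine finrank_vectorSpan_lt_of_ssubset (φ.symm _).2 (hne _) (φ.symm _).2.subset ?_
      have hlt : (⟨cubeFace sᶜ v, isExposed_cubeFace _ _⟩ : Face (unitCube n)) <
          ⟨cubeFace (insert i s)ᶜ v, isExposed_cubeFace _ _⟩ :=
        cubeFace_ssubset v (Finset.compl_ssubset_compl.2 (Finset.ssubset_insert hi))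
      exact φ.symm.lt_iff_lt.2 hlt
  have h := key Finset.univ
  have hle : K Finset.univᶜ ≤ n := (Submodule.finrank_le _).trans_eq finrank_euclideanSpace_fin
  rw [Finset.card_univ, Fintype.card_fin] at h
  have h0 := Submodule.finrank_eq_zero.1 (by omega : K Finset.univ = 0)
  rw [vectorSpan_eq_bot_iff_subsingleton] at h0
  obtain ⟨x, hx⟩ := hne Finset.univ
  exact ⟨x, h0.eq_singleton_of_mem hx⟩

/-- A combinatorial cube has a labeling of its vertices and facets. -/
theorem CombinatoriallyEquivalent.exists_isCubeLabeling {n : ℕ} {C : Set (Euc n)}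
    (h : CombinatoriallyEquivalent C (unitCube n)) : ∃ X F, IsCubeLabeling C X F := by
  obtain ⟨φ⟩ := h
  choose X hX using exists_symm_cubeVertex φ
  refine ⟨X, fun i s => φ.symm ⟨cubeFace {i} fun _ => s, isExposed_cubeFace _ _⟩,
    fun i s => ?_, fun G hG => ?_, fun v => ?_, fun G hG hne => ?_, fun v i s => ?_⟩
  · exact IsFacet.map φ.symm (G := ⟨cubeFace {i} fun _ => s, isExposed_cubeFace _ _⟩)
      (isFacet_cubeFace_singleton _ _)
  · obtain ⟨i, v, hv⟩ := exists_eq_cubeFace_of_isFacet (IsFacet.map φ (G := ⟨G, hG.1⟩) hG)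
    have hv' : cubeFace {i} v = cubeFace {i} fun _ => v i := by
      simp [cubeFace]
    have : φ ⟨G, hG.1⟩ = ⟨cubeFace {i} fun _ => v i, isExposed_cubeFace _ _⟩ :=
      Subtype.ext (hv.trans hv')
    refine ⟨i, v i, ?_⟩
    rw [← this, OrderIso.symm_apply_apply]
  · have := (φ.symm ⟨cubeFace Finset.univ v, isExposed_cubeFace _ _⟩).2
    rwa [hX] at this
  · obtain ⟨v, hv⟩ := exists_cubeVertex_mem (φ ⟨G, hG⟩).2 (Face.nonempty_map φ hne)
    refine ⟨v, ?_⟩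
    have hle : (⟨cubeFace Finset.univ v, isExposed_cubeFace _ _⟩ : Face (unitCube n)) ≤
        φ ⟨G, hG⟩ := by
      rw [← Subtype.coe_le_coe]
      exact (cubeFace_univ v).trans_le (Set.singleton_subset_iff.2 hv)
    have hle' := (φ.symm_apply_le).2 hle
    rw [← Subtype.coe_le_coe, hX] at hle'
    exact hle' rfl
  · rw [← Set.singleton_subset_iff, ← hX]
    refine (φ.symm.le_iff_le (x := ⟨cubeFace Finset.univ v, isExposed_cubeFace _ _⟩)
      (y := ⟨cubeFace {i} fun _ => s, isExposed_cubeFace _ _⟩)).trans ?_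
    rw [← Subtype.coe_le_coe]
    change cubeFace Finset.univ v ⊆ cubeFace {i} (fun _ => s) ↔ _
    simp [cubeFace_univ, cubeVertex_mem_cubeFace]

/-! ### Facet inequalities and edge vectors -/

/-- `C` satisfies the inequalities `⟨A i s, x⟩ ≤ B i s`, with equality at the labeled points as at
the vertices of the `n`-cube. -/
structure IsCubeDescription {n : ℕ} (C : Set (Euc n)) (X : (Fin n → Bool) → Euc n)
    (A : Fin n → Bool → Euc n) (B : Fin n → Bool → ℝ) : Prop where
  mem : ∀ v, X v ∈ C
  inner_le : ∀ i s, ∀ x ∈ C, inner ℝ (A i s) x ≤ B i s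
  inner_eq_iff : ∀ v i s, inner ℝ (A i s) (X v) = B i s ↔ v i = s

/-- The inequalities are arbitrary here, so that the result covers those of the given linear program
as well as those obtained from exposedness. -/
theorem IsCubeLabeling.isCubeDescription {n : ℕ} {C : Set (Euc n)} {X : (Fin n → Bool) → Euc n}
    {F : Fin n → Bool → Set (Euc n)} (h : IsCubeLabeling C X F) {A : Fin n → Bool → Euc n}
    {B : Fin n → Bool → ℝ} (hle : ∀ i s, ∀ x ∈ C, inner ℝ (A i s) x ≤ B i s)
    (heq : ∀ i s, F i s = {x ∈ C | inner ℝ (A i s) x = B i s}) : IsCubeDescription C X A B := by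
  have hmem : ∀ v, X v ∈ C := fun v => (h.mem_vertices v).subset rfl
  refine ⟨hmem, hle, fun v i s => ?_⟩
  rw [← h.mem_facet_iff, heq]
  exact ⟨fun h => ⟨hmem v, h⟩, fun h => h.2⟩

theorem IsCubeLabeling.exists_isCubeDescription {n : ℕ} {C : Set (Euc n)}
    {X : (Fin n → Bool) → Euc n} {F : Fin n → Bool → Set (Euc n)} (h : IsCubeLabeling C X F) :
    ∃ A B, IsCubeDescription C X A B := by
  have key : ∀ i s, ∃ (a : Euc n) (b : ℝ), (∀ x ∈ C, inner ℝ a x ≤ b) ∧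
      F i s = {x ∈ C | inner ℝ a x = b} := fun i s => by
    obtain ⟨hexp, ⟨x₀, hx₀⟩, -⟩ := h.isFacet i s
    obtain ⟨l, hl⟩ := hexp ⟨x₀, hx₀⟩
    have hx₀' := hx₀
    rw [hl] at hx₀'
    refine ⟨(InnerProductSpace.toDual ℝ (Euc n)).symm l, l x₀, ?_, ?_⟩
    · simpa using hx₀'.2
    · rw [hl]
      ext x
      simp only [InnerProductSpace.toDual_symm_apply, Set.mem_ofPred_eq]
      exact and_congr_right fun hx => ⟨fun h => le_antisymm (hx₀'.2 x hx) (h x₀ hx₀'.1),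
        fun h => h ▸ hx₀'.2⟩
  choose A B hAB using key
  exact ⟨A, B, h.isCubeDescription (fun i s => (hAB i s).1) fun i s => (hAB i s).2⟩

/-- The edge vector from the vertex with label `v` to its neighbor in coordinate `i`. -/
def edgeVector {n : ℕ} (X : (Fin n → Bool) → Euc n) (v : Fin n → Bool) (i : Fin n) : Euc n :=
  X (flipAt v i) - X v

namespace IsCubeDescription

variable {n : ℕ} {C : Set (Euc n)} {X : (Fin n → Bool) → Euc n} {A : Fin n → Bool → Euc n}
  {B : Fin n → Bool → ℝ}

theorem inner_edgeVector_of_ne (h : IsCubeDescription C X A B) (v : Fin n → Bool) {i j : Fin n}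
    (hij : j ≠ i) : inner ℝ (A j (v j)) (edgeVector X v i) = 0 := by
  rw [edgeVector, inner_sub_right, (h.inner_eq_iff v j _).2 rfl,
    (h.inner_eq_iff (flipAt v i) j _).2 (flipAt_of_ne v hij), sub_self]

theorem inner_lt (h : IsCubeDescription C X A B) {v : Fin n → Bool} {i : Fin n} {s : Bool}
    (hs : v i ≠ s) : inner ℝ (A i s) (X v) < B i s :=
  lt_of_le_of_ne (h.inner_le i s _ (h.mem v)) fun he => hs ((h.inner_eq_iff v i s).1 he)

theorem inner_edgeVector_neg (h : IsCubeDescription C X A B) (v : Fin n → Bool) (i : Fin n) :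
    inner ℝ (A i (v i)) (edgeVector X v i) < 0 := by
  rw [edgeVector, inner_sub_right, (h.inner_eq_iff v i _).2 rfl, sub_neg]
  exact h.inner_lt (by simp)

theorem inner_not_edgeVector_pos (h : IsCubeDescription C X A B) (v : Fin n → Bool) (i : Fin n) :
    0 < inner ℝ (A i (!v i)) (edgeVector X v i) := by
  rw [edgeVector, inner_sub_right, (h.inner_eq_iff (flipAt v i) i _).2 (flipAt_self v i), sub_pos]
  exact h.inner_lt (by simp)

/-- Pairing a linear relation with the edge vector in coordinate `i` isolates the coefficient of
index `i`. -/
theorem linearIndependent (h : IsCubeDescription C X A B) (v : Fin n → Bool) :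
    LinearIndependent ℝ fun i => A i (v i) := by
  rw [Fintype.linearIndependent_iff]
  intro g hg i
  have h1 : inner ℝ (∑ j, g j • A j (v j)) (edgeVector X v i) = 0 := by rw [hg, inner_zero_left]
  rw [sum_inner, Finset.sum_eq_single i] at h1
  · rw [real_inner_smul_left] at h1
    exact (mul_eq_zero.1 h1).resolve_right (h.inner_edgeVector_neg v i).ne
  · intro j _ hj
    rw [real_inner_smul_left, h.inner_edgeVector_of_ne v hj, mul_zero]
  · simp

theorem eq_zero_of_inner_eq_zero (h : IsCubeDescription C X A B) (v : Fin n → Bool) {z : Euc n}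
    (hz : ∀ i, inner ℝ (A i (v i)) z = 0) : z = 0 := by
  have hspan := (h.linearIndependent v).span_eq_top_of_card_eq_finrank' (by simp)
  have hle : Submodule.span ℝ (Set.range fun i => A i (v i)) ≤ LinearMap.ker (innerₗ (Euc n) z) := by
    refine Submodule.span_le.2 ?_
    rintro _ ⟨i, rfl⟩
    simpa [real_inner_comm] using hz i
  have : z ∈ LinearMap.ker (innerₗ (Euc n) z) := hle (hspan ▸ Submodule.mem_top)
  simpa using this

/-- The edge vectors at a vertex are a basis, dual to the normals up to scaling. -/
theorem eq_sum_edgeVector (h : IsCubeDescription C X A B) (v : Fin n → Bool) (z : Euc n) :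
    z = ∑ i, (inner ℝ (A i (v i)) z / inner ℝ (A i (v i)) (edgeVector X v i)) •
      edgeVector X v i := by
  rw [← sub_eq_zero]
  refine h.eq_zero_of_inner_eq_zero v fun j => ?_
  rw [inner_sub_right, inner_sum, Finset.sum_eq_single j]
  · rw [real_inner_smul_right, div_mul_cancel₀ _ (h.inner_edgeVector_neg v j).ne, sub_self]
  · intro i _ hi
    rw [real_inner_smul_right, h.inner_edgeVector_of_ne v hi.symm, mul_zero]
  · simp

/-- If a point of `C` is better than a vertex, some edge at this vertex is improving and leaves a
facet that does not contain the better point. -/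
theorem exists_improving (h : IsCubeDescription C X A B) {v : Fin n → Bool} {c y : Euc n}
    (hy : y ∈ C) (hlt : inner ℝ c y < inner ℝ c (X v)) :
    ∃ i, inner ℝ c (edgeVector X v i) < 0 ∧ inner ℝ (A i (v i)) y ≠ B i (v i) := by
  by_contra! hcon
  have h1 : inner ℝ c (y - X v) < 0 := by rw [inner_sub_right]; linarith
  rw [h.eq_sum_edgeVector v (y - X v), inner_sum] at h1
  refine h1.not_ge (Finset.sum_nonneg fun i _ => ?_)
  have h2 : inner ℝ (A i (v i)) (y - X v) = inner ℝ (A i (v i)) y - B i (v i) := by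
    rw [inner_sub_right, (h.inner_eq_iff v i _).2 rfl]
  rw [real_inner_smul_right, h2]
  rcases lt_or_ge (inner ℝ c (edgeVector X v i)) 0 with hi | hi
  · simp [hcon i hi]
  · exact mul_nonneg (div_nonneg_of_nonpos (sub_nonpos.2 (h.inner_le i _ y hy))
      (h.inner_edgeVector_neg v i).le) hi

theorem injective (h : IsCubeDescription C X A B) : Function.Injective X := fun v w hvw => by
  funext i
  rw [← h.inner_eq_iff v i (w i), hvw, h.inner_eq_iff]

/-- Vertices whose labels differ in one coordinate span an edge. -/
theorem isExposed_segment (h : IsCubeDescription C X A B) (hC : Convex ℝ C) (v : Fin n → Bool)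
    (i : Fin n) : IsExposed ℝ C (segment ℝ (X v) (X (flipAt v i))) := by
  convert isExposed_of_tight (Finset.univ.erase i) (fun j => A j (v j)) (fun j => B j (v j))
    (fun j _ => h.inner_le j (v j)) (h.mem v) (fun j _ => (h.inner_eq_iff v j _).2 rfl) using 1
  ext y
  constructor
  · intro hy
    refine ⟨hC.segment_subset (h.mem _) (h.mem _) hy, fun j hj => ?_⟩
    have hj := Finset.ne_of_mem_erase hj
    obtain ⟨s, t, -, -, hst, rfl⟩ := hy
    rw [inner_add_right, real_inner_smul_right, real_inner_smul_right,
      (h.inner_eq_iff v j _).2 rfl, (h.inner_eq_iff (flipAt v i) j _).2 (flipAt_of_ne v hj),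
      ← add_mul, hst, one_mul]
  · rintro ⟨hy, htight⟩
    have h1 := h.eq_sum_edgeVector v (y - X v)
    rw [Finset.sum_eq_single i] at h1
    · set r := inner ℝ (A i (v i)) (y - X v) / inner ℝ (A i (v i)) (edgeVector X v i)
      have hr0 : 0 ≤ r := by
        refine div_nonneg_of_nonpos ?_ (h.inner_edgeVector_neg v i).le
        rw [inner_sub_right, (h.inner_eq_iff v i _).2 rfl]
        exact sub_nonpos.2 (h.inner_le i _ y hy)
      -- The edge ends at the opposite facet, which is tight at the flipped vertex.
      have hr1 : r ≤ 1 := by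
        have h2 : inner ℝ (A i (!v i)) (y - X v) ≤ inner ℝ (A i (!v i)) (edgeVector X v i) := by
          rw [edgeVector, inner_sub_right, inner_sub_right,
            (h.inner_eq_iff (flipAt v i) i _).2 (flipAt_self v i)]
          exact sub_le_sub_right (h.inner_le i _ y hy) _
        rw [h1, real_inner_smul_right] at h2
        exact (mul_le_iff_le_one_left (h.inner_not_edgeVector_pos v i)).1 h2
      rw [segment_eq_image']
      exact ⟨r, ⟨hr0, hr1⟩, by
        change X v + r • edgeVector X v i = y
        rw [← h1, add_sub_cancel]⟩
    · intro j _ hj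
      rw [inner_sub_right, htight j (Finset.mem_erase.2 ⟨hj, Finset.mem_univ j⟩),
        (h.inner_eq_iff v j _).2 rfl, sub_self, zero_div, zero_smul]
    · simp

/-- If the segment between two vertices is a face, their labels differ in at most one
coordinate. -/
theorem eq_flipAt_of_isExposed_segment (h : IsCubeDescription C X A B)
    (hX : ∀ v, IsExposed ℝ C {X v}) {v w : Fin n → Bool}
    (hvw : IsExposed ℝ C (segment ℝ (X v) (X w))) {i : Fin n} (hi : w i ≠ v i) :
    w = flipAt v i := by
  obtain ⟨l, hl⟩ := hvw ⟨_, left_mem_segment ℝ _ _⟩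
  have hv : X v ∈ segment ℝ (X v) (X w) := left_mem_segment ℝ _ _
  have hw : X w ∈ segment ℝ (X v) (X w) := right_mem_segment ℝ _ _
  have hseg := hl
  rw [hl] at hv hw
  have hle : ∀ j, l (edgeVector X v j) ≤ 0 := fun j => by
    rw [edgeVector, map_sub, sub_nonpos]
    exact hv.2 _ (h.mem _)
  have hnn : ∀ j, 0 ≤ inner ℝ (A j (v j)) (X w - X v) / inner ℝ (A j (v j)) (edgeVector X v j) :=
    fun j => by
      refine div_nonneg_of_nonpos ?_ (h.inner_edgeVector_neg v j).le
      rw [inner_sub_right, (h.inner_eq_iff v j _).2 rfl]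
      exact sub_nonpos.2 (h.inner_le j _ _ (h.mem w))
  have hsum : l (X w - X v) = 0 := by
    rw [map_sub, sub_eq_zero]
    exact le_antisymm (hv.2 _ hw.1) (hw.2 _ hv.1)
  rw [h.eq_sum_edgeVector v (X w - X v), map_sum] at hsum
  -- Nonnegative coefficients times nonpositive values of `l` add up to zero, so each product
  -- vanishes. In coordinate `i` the coefficient is nonzero, hence `l` is also maximal at the
  -- flipped vertex, which therefore lies on the segment.
  have h0 := (Finset.sum_eq_zero_iff_of_nonpos fun j _ => by
    rw [map_smul, smul_eq_mul]
    exact mul_nonpos_of_nonneg_of_nonpos (hnn j) (hle j)).1 hsum i (Finset.mem_univ i)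
  rw [map_smul, smul_eq_mul] at h0
  have hpos : inner ℝ (A i (v i)) (X w - X v) / inner ℝ (A i (v i)) (edgeVector X v i) ≠ 0 := by
    refine div_ne_zero ?_ (h.inner_edgeVector_neg v i).ne
    rw [inner_sub_right, (h.inner_eq_iff v i _).2 rfl]
    exact (sub_neg.2 (h.inner_lt hi)).ne
  have hl0 := (mul_eq_zero.1 h0).resolve_left hpos
  rw [edgeVector, map_sub, sub_eq_zero] at hl0
  have hmem : X (flipAt v i) ∈ segment ℝ (X v) (X w) := by
    rw [hseg]
    exact ⟨h.mem _, fun y hy => hl0 ▸ hv.2 y hy⟩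
  -- An extreme point on the segment is one of its ends, and it is not `X v`.
  have hext : X (flipAt v i) ∈ C.extremePoints ℝ :=
    (hX (flipAt v i)).isExtreme.mem_extremePoints
  rcases (mem_extremePoints_iff_forall_segment.1 hext).2 _ (h.mem v) _ (h.mem w) hmem with h1 | h1
  · have := congrFun (h.injective h1) i
    simp at this
  · exact h.injective h1

end IsCubeDescription

/-! ### Hamming distance and monotone paths -/

theorem hammingDist_flipAt_add_one {n : ℕ} {v w : Fin n → Bool} {i : Fin n} (h : v i ≠ w i) :
    hammingDist (flipAt v i) w + 1 = hammingDist v w := by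
  have hi : i ∉ Finset.univ.filter fun j => flipAt v i j ≠ w j := by
    simp [Bool.eq_not_of_ne h]
  rw [hammingDist, hammingDist, ← Finset.card_insert_of_notMem hi]
  congr 1
  ext j
  by_cases hj : j = i
  · subst hj
    simp [h]
  · simp [hj, flipAt_of_ne v hj]

theorem hammingDist_flipAt {n : ℕ} (v : Fin n → Bool) (i : Fin n) :
    hammingDist v (flipAt v i) = 1 := by
  rw [← hammingDist_flipAt_add_one (i := i) (by simp), hammingDist_self]

/-- Some linear functional takes distinct values on a finite family of distinct points. -/
theorem exists_inner_injective {n : ℕ} {κ : Type*} [Finite κ] {X : κ → Euc n}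
    (hX : Function.Injective X) : ∃ c : Euc n, Function.Injective fun k => inner ℝ c (X k) := by
  obtain ⟨f, hf⟩ := Module.exists_dual_forall_apply_ne_zero (K := ℝ)
    (fun p : {p : κ × κ // p.1 ≠ p.2} => X p.1.1 - X p.1.2)
    fun p => sub_ne_zero.2 (hX.ne p.2)
  refine ⟨(InnerProductSpace.toDual ℝ (Euc n)).symm f.toContinuousLinearMap, fun k k' hk => ?_⟩
  by_contra hne
  refine hf ⟨(k, k'), hne⟩ ?_
  simpa [sub_eq_zero] using hk

theorem MonotonePath.target_mem {n : ℕ} {C : Set (Euc n)} {c x y : Euc n} {k : ℕ}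
    (h : MonotonePath C c k x y) : y ∈ vertices C := by
  induction h with
  | nil x hx => exact hx
  | cons k x y z _ _ _ ih => exact ih

namespace IsCubeLabeling

variable {n : ℕ} {C : Set (Euc n)} {X : (Fin n → Bool) → Euc n} {F : Fin n → Bool → Set (Euc n)}

theorem exists_eq_of_mem_vertices (h : IsCubeLabeling C X F) {x : Euc n} (hx : x ∈ vertices C) :
    ∃ v, X v = x :=
  h.exists_mem {x} hx ⟨x, rfl⟩

theorem injective (h : IsCubeLabeling C X F) : Function.Injective X := fun v w hvw => by
  funext i
  rw [← h.mem_facet_iff v i (w i), hvw, h.mem_facet_iff]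

/-- By compactness the minimizers form a nonempty exposed face, which contains a labeled vertex. -/
theorem exists_isOptimal (h : IsCubeLabeling C X F) (hC : IsPolytope C) (c : Euc n) :
    ∃ v, IsOptimal C c (X v) := by
  obtain ⟨s, hs, rfl⟩ := hC
  have hcomp := hs.isCompact_convexHull ℝ
  have hne : (convexHull ℝ s).Nonempty :=
    ⟨_, (h.mem_vertices fun _ => false).subset rfl⟩
  obtain ⟨x, hx, hmin⟩ := hcomp.exists_isMinOn hne (f := fun x => inner ℝ c x) (by fun_prop)
  obtain ⟨v, hv, hv'⟩ := h.exists_mem ((innerSL ℝ (-c)).toExposed (convexHull ℝ s))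
    ContinuousLinearMap.toExposed.isExposed
    ⟨x, hx, fun y hy => by simpa [inner_neg_left] using hmin hy⟩
  exact ⟨v, hv, fun z hz => by simpa [inner_neg_left] using hv' z hz⟩

/-- The shortest monotone path to an optimal vertex is at most as long as the Hamming distance. -/
theorem exists_monotonePath (h : IsCubeLabeling C X F) (hC : Convex ℝ C) {c : Euc n}
    {w : Fin n → Bool} (hw : IsOptimal C c (X w)) :
    ∀ (d : ℕ) (v : Fin n → Bool), hammingDist v w = d →
      ∃ k ≤ d, ∃ y, IsOptimal C c y ∧ MonotonePath C c k (X v) y := by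
  obtain ⟨A, B, hd⟩ := h.exists_isCubeDescription
  intro d
  induction d with
  | zero =>
    intro v hv
    rw [hammingDist_eq_zero.1 hv]
    exact ⟨0, le_rfl, X w, hw, .nil _ (h.mem_vertices w)⟩
  | succ d ih =>
    intro v hv
    rcases (hw.2 _ (hd.mem v)).lt_or_eq with hlt | heq
    · obtain ⟨i, hi, hne⟩ := hd.exists_improving hw.1 hlt
      rw [Ne, hd.inner_eq_iff] at hne
      have hdist := hammingDist_flipAt_add_one (Ne.symm hne)
      obtain ⟨k, hk, y, hy, hp⟩ := ih (flipAt v i) (by omega)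
      refine ⟨k + 1, by omega, y, hy, .cons k _ (X (flipAt v i)) _
        ⟨h.mem_vertices _, h.mem_vertices _, fun he => ?_, hd.isExposed_segment hC v i⟩ ?_ hp⟩
      · have := congrFun (h.injective he) i
        simp at this
      · rwa [edgeVector, inner_sub_right, sub_neg] at hi
    -- The objective may be degenerate: a vertex that ties with `X w` is itself optimal, and the
    -- path stops there.
    · exact ⟨0, Nat.zero_le _, X v, ⟨hd.mem v, fun z hz => heq ▸ hw.2 z hz⟩,
        .nil _ (h.mem_vertices v)⟩

/-- Every monotone path is at least as long as the Hamming distance of its ends. -/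
theorem hammingDist_le_of_monotonePath (h : IsCubeLabeling C X F) {c x y : Euc n} {k : ℕ}
    (hp : MonotonePath C c k x y) :
    ∀ v w, X v = x → X w = y → hammingDist v w ≤ k := by
  obtain ⟨A, B, hd⟩ := h.exists_isCubeDescription
  induction hp with
  | nil x hx =>
    rintro v w rfl hw
    rw [h.injective hw, hammingDist_self]
  | cons k x y z hxy _ _ ih =>
    rintro v w rfl hw
    obtain ⟨u, rfl⟩ := h.exists_eq_of_mem_vertices hxy.2.1
    obtain ⟨i, hi⟩ := Function.ne_iff.1 fun he : u = v => hxy.2.2.1 (he ▸ rfl)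
    have hu := hd.eq_flipAt_of_isExposed_segment h.mem_vertices hxy.2.2.2 hi
    have h1 := ih u w rfl hw
    have h2 := hammingDist_triangle v u w
    have h3 := hammingDist_flipAt v i
    rw [← hu] at h3
    omega

theorem monotoneDiameter_le (h : IsCubeLabeling C X F) (hC : IsPolytope C) :
    monotoneDiameter C ≤ n := by
  refine iSup₂_le fun c _ => iSup₂_le fun x hx => ?_
  obtain ⟨v, rfl⟩ := h.exists_eq_of_mem_vertices hx
  obtain ⟨w, hw⟩ := h.exists_isOptimal hC c
  have hconv : Convex ℝ C := by
    obtain ⟨s, -, rfl⟩ := hC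
    exact convex_convexHull ℝ s
  obtain ⟨k, hk, hp⟩ := h.exists_monotonePath hconv hw _ v rfl
  refine (iInf₂_le k hp).trans (Nat.cast_le.2 (hk.trans ?_))
  simpa using hammingDist_le_card_fintype (x := v) (y := w)

theorem le_monotoneDiameter (h : IsCubeLabeling C X F) (hC : IsPolytope C) :
    (n : ℕ∞) ≤ monotoneDiameter C := by
  obtain ⟨c, hc⟩ := exists_inner_injective h.injective
  have hnd : NondegenerateObjective C c := by
    intro x hx y hy hxy
    obtain ⟨v, rfl⟩ := h.exists_eq_of_mem_vertices hx
    obtain ⟨w, rfl⟩ := h.exists_eq_of_mem_vertices hy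
    rw [hc hxy]
  obtain ⟨w, hw⟩ := h.exists_isOptimal hC c
  -- Start at the antipode of the optimal vertex, at Hamming distance `n`.
  refine le_iSup₂_of_le c hnd (le_iSup₂_of_le (X fun i => !w i) (h.mem_vertices _) ?_)
  refine le_iInf₂ fun k hk => Nat.cast_le.2 ?_
  obtain ⟨y, hy, hp⟩ := hk
  obtain ⟨u, rfl⟩ := h.exists_eq_of_mem_vertices hp.target_mem
  -- Nondegeneracy makes the optimal vertex unique, so every competing path ends at `X w`.
  obtain rfl : u = w := hc (le_antisymm (hy.2 _ hw.1) (hw.2 _ hy.1))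
  have := h.hammingDist_le_of_monotonePath hp _ _ rfl rfl
  simpa [hammingDist] using this

end IsCubeLabeling

/-! ### Simplex states and Bland's rule -/

/-- The facets through the vertex with label `v`, if `p` enumerates the facets. -/
def tightSet {n : ℕ} {ι : Type*} (p : Fin n × Bool ≃ ι) (v : Fin n → Bool) : Finset ι :=
  Finset.univ.map ⟨fun i => p (i, v i), fun _ _ h => congrArg Prod.fst (p.injective h)⟩

theorem mem_tightSet {n : ℕ} {ι : Type*} {p : Fin n × Bool ≃ ι} {v : Fin n → Bool} {k : ι} :
    k ∈ tightSet p v ↔ ∃ i, p (i, v i) = k := by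
  simp only [tightSet, Finset.mem_map, Finset.mem_univ, true_and]
  rfl

theorem mem_tightSet_apply {n : ℕ} {ι : Type*} {p : Fin n × Bool ≃ ι} {v : Fin n → Bool}
    {i : Fin n} {s : Bool} : p (i, s) ∈ tightSet p v ↔ v i = s := by
  simp [mem_tightSet]

theorem card_tightSet {n : ℕ} {ι : Type*} (p : Fin n × Bool ≃ ι) (v : Fin n → Bool) :
    (tightSet p v).card = n := by
  simp [tightSet]

theorem tightSet_flipAt {n : ℕ} {ι : Type*} [DecidableEq ι] (p : Fin n × Bool ≃ ι)
    (v : Fin n → Bool) (i : Fin n) :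
    tightSet p (flipAt v i) = insert (p (i, !v i)) ((tightSet p v).erase (p (i, v i))) := by
  ext k
  obtain ⟨⟨j, s⟩, rfl⟩ := p.surjective k
  rw [mem_tightSet_apply, Finset.mem_insert, Finset.mem_erase, mem_tightSet_apply]
  by_cases hj : j = i
  · subst hj
    cases s <;> cases h : v j <;> simp [h]
  · simp [flipAt_of_ne v hj, hj]

/-- The state of the simplex method at the vertex with label `v`. -/
def stateAt {n : ℕ} {ι : Type*} (X : (Fin n → Bool) → Euc n) (p : Fin n × Bool ≃ ι)
    (v : Fin n → Bool) : SimplexState n ι := ⟨X v, tightSet p v⟩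

namespace IsCubeDescription

variable {n : ℕ} {ι : Type*} {C : Set (Euc n)} {X : (Fin n → Bool) → Euc n} {a : ι → Euc n}
  {b : ι → ℝ} {p : Fin n × Bool ≃ ι}

theorem isBasic_stateAt (h : IsCubeDescription C X (fun i s => a (p (i, s))) fun i s => b (p (i, s)))
    (v : Fin n → Bool) : (stateAt X p v).IsBasic a b := by
  refine ⟨fun k hk => ?_, card_tightSet p v, ?_⟩
  · obtain ⟨i, rfl⟩ := mem_tightSet.1 hk
    exact (h.inner_eq_iff v i (v i)).2 rfl
  · have hli := h.linearIndependent v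
    have hmem : ∀ k : tightSet p v, p ((p.symm k).1, v (p.symm k).1) = k := fun k => by
      obtain ⟨i, hi⟩ := mem_tightSet.1 k.2
      simp [← hi]
    have hcomp := hli.comp (fun k : tightSet p v => (p.symm k).1) fun k k' hk => by
      apply Subtype.ext
      rw [← hmem k, ← hmem k']
      exact congrArg (fun i => p (i, v i)) hk
    have heq : (fun k : tightSet p v => a k) =
        (fun i => a (p (i, v i))) ∘ fun k : tightSet p v => (p.symm k).1 := by
      funext k
      simp [hmem k]
    exact heq ▸ hcomp

/-- Only `n` inequalities are tight at a vertex, so its basis is forced. This determines the initial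
state of any run. -/
theorem eq_stateAt_of_isBasic
    (h : IsCubeDescription C X (fun i s => a (p (i, s))) fun i s => b (p (i, s)))
    {S : SimplexState n ι} (hS : S.IsBasic a b) {v : Fin n → Bool} (hv : S.point = X v) :
    S = stateAt X p v := by
  obtain ⟨x, N⟩ := S
  obtain ⟨htight, hcard, -⟩ := hS
  dsimp only at hv htight hcard
  subst hv
  have hsub : N ⊆ tightSet p v := fun k hk => by
    obtain ⟨⟨i, s⟩, rfl⟩ := p.surjective k
    exact mem_tightSet_apply.2 ((h.inner_eq_iff v i s).1 (htight _ hk))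
  rw [stateAt, Finset.eq_of_subset_of_card_le hsub (by rw [card_tightSet, hcard])]

/-- The pivot direction of a nonbasic slack variable is a positive multiple of an edge vector. -/
theorem isPivotDirection_iff
    (h : IsCubeDescription C X (fun i s => a (p (i, s))) fun i s => b (p (i, s)))
    {v : Fin n → Bool} {i : Fin n} {d : Euc n} :
    IsPivotDirection a (tightSet p v) (p (i, v i)) d ↔
      d = (-inner ℝ (a (p (i, v i))) (edgeVector X v i))⁻¹ • edgeVector X v i := by
  have hneg := h.inner_edgeVector_neg v i
  have hval : inner ℝ (a (p (i, v i)))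
      ((-inner ℝ (a (p (i, v i))) (edgeVector X v i))⁻¹ • edgeVector X v i) = -1 := by
    rw [real_inner_smul_right, inv_neg, neg_mul, inv_mul_cancel₀ hneg.ne]
  have hval' : ∀ j, j ≠ i → inner ℝ (a (p (j, v j)))
      ((-inner ℝ (a (p (i, v i))) (edgeVector X v i))⁻¹ • edgeVector X v i) = 0 := fun j hj => by
    rw [real_inner_smul_right, h.inner_edgeVector_of_ne v hj, mul_zero]
  constructor
  · rintro ⟨-, h1, h2⟩
    rw [← sub_eq_zero]
    refine h.eq_zero_of_inner_eq_zero v fun j => ?_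
    rw [inner_sub_right, sub_eq_zero]
    by_cases hj : j = i
    · subst hj
      rw [h1, hval]
    · rw [hval' j hj, h2 _ (mem_tightSet.2 ⟨j, rfl⟩) (by simp [hj])]
  · rintro rfl
    refine ⟨mem_tightSet.2 ⟨i, rfl⟩, hval, fun k hk hne => ?_⟩
    obtain ⟨j, rfl⟩ := mem_tightSet.1 hk
    exact hval' j fun hj => hne (hj ▸ rfl)

/-- In the ratio test for movement along an edge, the facet at the other end attains the minimum,
and no other one does. -/
theorem inv_le_ratio
    (h : IsCubeDescription C X (fun i s => a (p (i, s))) fun i s => b (p (i, s)))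
    {v : Fin n → Bool} {i : Fin n} {r : ℝ} (hr : 0 < r) {k : ι}
    (hk : 0 < inner ℝ (a k) (r • edgeVector X v i)) :
    r⁻¹ ≤ (b k - inner ℝ (a k) (X v)) / inner ℝ (a k) (r • edgeVector X v i) ∧
    (r⁻¹ = (b k - inner ℝ (a k) (X v)) / inner ℝ (a k) (r • edgeVector X v i) ↔
      k = p (i, !v i)) := by
  obtain ⟨⟨j, s⟩, rfl⟩ := p.surjective k
  have hmul : r⁻¹ * inner ℝ (a (p (j, s))) (r • edgeVector X v i) =
      inner ℝ (a (p (j, s))) (X (flipAt v i)) - inner ℝ (a (p (j, s))) (X v) := by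
    rw [real_inner_smul_right, inv_mul_cancel_left₀ hr.ne', edgeVector, inner_sub_right]
  rw [le_div_iff₀ hk, eq_div_iff hk.ne', hmul, sub_left_inj, h.inner_eq_iff]
  refine ⟨sub_le_sub_right (h.inner_le j s _ (h.mem _)) _, fun hs => ?_, fun hs => ?_⟩
  · by_cases hj : j = i
    · subst hj
      simpa using hs.symm
    · rw [flipAt_of_ne v hj] at hs
      rw [← hs, real_inner_smul_right, h.inner_edgeVector_of_ne v hj, mul_zero] at hk
      exact absurd hk (lt_irrefl 0)
  · obtain ⟨rfl, rfl⟩ := Prod.mk.inj (p.injective hs)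
    exact flipAt_self v j

/-- The minimum ratio is attained only by the facet at the far end of the edge, so tie breaking
never matters. -/
theorem isLeaving_iff [LinearOrder ι]
    (h : IsCubeDescription C X (fun i s => a (p (i, s))) fun i s => b (p (i, s)))
    {v : Fin n → Bool} {i : Fin n} {r : ℝ} (hr : 0 < r) {j : ι} {t : ℝ} :
    IsLeaving a b (X v) (r • edgeVector X v i) j t ↔ j = p (i, !v i) ∧ t = r⁻¹ := by
  have hpos : 0 < inner ℝ (a (p (i, !v i))) (r • edgeVector X v i) := by
    rw [real_inner_smul_right]
    exact mul_pos hr (h.inner_not_edgeVector_pos v i)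
  have heq := (h.inv_le_ratio hr hpos).2.2 rfl
  constructor
  · rintro ⟨hj, ht, hmin⟩
    have htr : t = r⁻¹ :=
      le_antisymm ((hmin _ hpos).1.trans_eq heq.symm) (ht ▸ (h.inv_le_ratio hr hj).1)
    exact ⟨(h.inv_le_ratio hr hj).2.1 (htr ▸ ht), htr⟩
  · rintro ⟨rfl, rfl⟩
    exact ⟨hpos, heq, fun k hk => ⟨(h.inv_le_ratio hr hk).1,
      fun hk' => ((h.inv_le_ratio hr hk).2.1 hk').ge⟩⟩

/-- Bland's rule chooses the improving edge that leaves the facet of smallest index. -/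
theorem blandStep_stateAt_iff [LinearOrder ι]
    (h : IsCubeDescription C X (fun i s => a (p (i, s))) fun i s => b (p (i, s)))
    {c : Euc n} {v : Fin n → Bool} {T : SimplexState n ι} :
    BlandStep a b c (stateAt X p v) T ↔
      ∃ i, inner ℝ c (edgeVector X v i) < 0 ∧
        (∀ j, inner ℝ c (edgeVector X v j) < 0 → p (i, v i) ≤ p (j, v j)) ∧
        T = stateAt X p (flipAt v i) := by
  have hr : ∀ i, 0 < (-inner ℝ (a (p (i, v i))) (edgeVector X v i))⁻¹ := fun i =>
    inv_pos.2 (neg_pos.2 (h.inner_edgeVector_neg v i))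
  have hcost : ∀ i, inner ℝ c
      ((-inner ℝ (a (p (i, v i))) (edgeVector X v i))⁻¹ • edgeVector X v i) < 0 ↔
        inner ℝ c (edgeVector X v i) < 0 := fun i => by
    rw [real_inner_smul_right]
    exact ⟨fun hi => (pos_iff_neg_of_mul_neg hi).1 (hr i), mul_neg_of_pos_of_neg (hr i)⟩
  have hend : ∀ i, X v + (-inner ℝ (a (p (i, v i))) (edgeVector X v i))⁻¹⁻¹ •
      (-inner ℝ (a (p (i, v i))) (edgeVector X v i))⁻¹ • edgeVector X v i = X (flipAt v i) :=
    fun i => by rw [inv_smul_smul₀ (hr i).ne', edgeVector, add_sub_cancel]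
  constructor
  · rintro ⟨k, j, d, t, hd, hc, hmin, hleave, hpoint, hbasis⟩
    obtain ⟨i, rfl⟩ := mem_tightSet.1 hd.1
    obtain rfl := h.isPivotDirection_iff.1 hd
    obtain ⟨rfl, rfl⟩ := (h.isLeaving_iff (hr i)).1 hleave
    refine ⟨i, (hcost i).1 hc, fun j hj =>
      hmin _ _ (h.isPivotDirection_iff.2 rfl) ((hcost j).2 hj), ?_⟩
    obtain ⟨x, N⟩ := T
    simp only [stateAt] at hpoint hbasis ⊢
    rw [hpoint, hbasis, hend, tightSet_flipAt]
  · rintro ⟨i, hi, hmin, rfl⟩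
    refine ⟨p (i, v i), p (i, !v i), _, _, h.isPivotDirection_iff.2 rfl, (hcost i).2 hi,
      fun k d hd hc => ?_, (h.isLeaving_iff (hr i)).2 ⟨rfl, rfl⟩, (hend i).symm,
      tightSet_flipAt p v i⟩
    obtain ⟨j, rfl⟩ := mem_tightSet.1 hd.1
    obtain rfl := h.isPivotDirection_iff.1 hd
    exact hmin j ((hcost j).1 hc)

theorem exists_isBlandRun [LinearOrder ι]
    (h : IsCubeDescription C X (fun i s => a (p (i, s))) fun i s => b (p (i, s)))
    (c : Euc n) (v : Fin n → Bool) :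
    ∃ S : ℕ → SimplexState n ι, IsBlandRun a b c S ∧ (S 0).point = X v := by
  have hnext : ∀ S : SimplexState n ι, ∃ T, BlandStep a b c S T ∨
      ((∀ T, ¬ BlandStep a b c S T) ∧ T = S) := fun S => by
    by_cases hS : ∃ T, BlandStep a b c S T
    · exact hS.imp fun T hT => Or.inl hT
    · exact ⟨S, Or.inr ⟨not_exists.1 hS, rfl⟩⟩
  choose next hnext using hnext
  exact ⟨fun k => Nat.rec (stateAt X p v) (fun _ => next) k,
    ⟨h.isBasic_stateAt v, fun k => hnext _⟩, rfl⟩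

/-- If the facets that miss the optimal vertex `X w` come first, every pivot of Bland's rule
leaves such a facet, as long as the current vertex is not optimal. -/
theorem blandRun_isOptimal [LinearOrder ι]
    (h : IsCubeDescription C X (fun i s => a (p (i, s))) fun i s => b (p (i, s)))
    {c : Euc n} {w : Fin n → Bool} (hw : IsOptimal C c (X w))
    (hp : ∀ i j, p (i, !w i) < p (j, w j)) {S : ℕ → SimplexState n ι} (hS : IsBlandRun a b c S)
    {v : Fin n → Bool} (hv : (S 0).point = X v) : ∃ k ≤ n, IsOptimal C c (S k).point := by
  by_contra! hcon
  -- Since no state up to step `n` is optimal, each pivot lowers the Hamming distance to `w` by one;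
  -- after `n` pivots it is zero, a contradiction.
  have key : ∀ k ≤ n, ∃ u, S k = stateAt X p u ∧ hammingDist u w + k ≤ n := by
    intro k
    induction k with
    | zero =>
      refine fun _ => ⟨v, h.eq_stateAt_of_isBasic hS.1 hv, ?_⟩
      simpa using hammingDist_le_card_fintype (x := v) (y := w)
    | succ k ih =>
      intro hk
      obtain ⟨u, hu, hdist⟩ := ih (by omega)
      have hnot := hcon k (by omega)
      rw [hu] at hnot
      have hlt : inner ℝ c (X w) < inner ℝ c (X u) := by
        by_contra hge
        exact hnot ⟨h.mem u, fun z hz => (not_lt.1 hge).trans (hw.2 z hz)⟩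
      obtain ⟨j, hj, hne⟩ := h.exists_improving hw.1 hlt
      rw [Ne, h.inner_eq_iff] at hne
      have hstep := hS.2 k
      rw [hu] at hstep
      have hex : ∃ T, BlandStep a b c (stateAt X p u) T := by
        obtain ⟨i, hi, hmin⟩ := Finset.exists_min_image
          (Finset.univ.filter fun i => inner ℝ c (edgeVector X u i) < 0) (fun i => p (i, u i))
          ⟨j, by simpa using hj⟩
        exact ⟨_, h.blandStep_stateAt_iff.2 ⟨i, by simpa using hi, fun j hj =>
          hmin j (by simpa using hj), rfl⟩⟩
      rcases hstep with hstep | ⟨hno, -⟩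
      · obtain ⟨i, hi, hmin, hT⟩ := h.blandStep_stateAt_iff.1 hstep
        refine ⟨flipAt u i, hT, ?_⟩
        -- Otherwise the entering facet would contain `X w`, while the improving edge in coordinate
        -- `j` leaves a facet missing `X w`, which has smaller index.
        have hne' : u i ≠ w i := fun he => by
          have h1 := hmin j hj
          rw [Bool.eq_not_of_ne (Ne.symm hne), he] at h1
          exact h1.not_gt (hp j i)
        have := hammingDist_flipAt_add_one hne'
        omega
      · exact absurd hex (not_exists.2 hno)
  obtain ⟨u, hu, hdist⟩ := key n le_rfl
  have hu0 : hammingDist u w = 0 := by omega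
  refine hcon n le_rfl ?_
  rw [hu, hammingDist_eq_zero.1 hu0]
  exact hw

end IsCubeDescription

/-! ### Ordering the facets and the main theorem -/

/-- An enumeration of the facets of a cube in which those that miss the vertex with label `w` come
first. -/
theorem exists_facet_enumeration {n : ℕ} (w : Fin n → Bool) :
    ∃ p : Fin n × Bool ≃ Fin (2 * n), ∀ i j, p (i, !w i) < p (j, w j) := by
  -- Recode the sign of a facet by whether the facet contains the vertex `w`. `finProdFinEquiv`
  -- takes this flag as the leading digit, so the facets missing `w` fill the first block of `n`
  -- indices.
  let e : Fin n × Bool ≃ Bool × Fin n :=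
    { toFun := fun q => (q.2 == w q.1, q.1)
      invFun := fun q => (q.2, q.1 == w q.2)
      left_inv := fun ⟨i, s⟩ => by cases s <;> cases h : w i <;> simp [h]
      right_inv := fun ⟨s, i⟩ => by cases s <;> cases h : w i <;> simp [h] }
  refine ⟨e.trans ((Equiv.prodCongr finTwoEquiv.symm (Equiv.refl _)).trans finProdFinEquiv),
    fun i j => ?_⟩
  have hi : (finTwoEquiv.symm ((!w i) == w i) : ℕ) = 0 := by cases w i <;> rfl
  have hj : (finTwoEquiv.symm (w j == w j) : ℕ) = 1 := by cases w j <;> rfl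
  rw [Fin.lt_def]
  simp only [e, Equiv.trans_apply, Equiv.coe_fn_mk, Equiv.prodCongr_apply, Prod.map,
    Equiv.refl_apply, finProdFinEquiv_apply_val, hi, hj]
  omega

theorem mainTheorem2 (n : ℕ) (C : Set (Euc n)) (hC : IsPolytope C)
    (hcube : CombinatoriallyEquivalent C (unitCube n)) :
    monotoneDiameter C = (n : ℕ∞) ∧
    ∀ c : Euc n, ∃ F : Fin (2 * n) ≃ {G : Set (Euc n) // IsFacet C G},
      ∀ (a : Fin (2 * n) → Euc n) (b : Fin (2 * n) → ℝ),
        IsFacetDescription C (fun i => (F i : Set (Euc n))) a b →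
        ∀ x ∈ vertices C,
          (∃ S : ℕ → SimplexState n (Fin (2 * n)), IsBlandRun a b c S ∧ (S 0).point = x) ∧
          ∀ S : ℕ → SimplexState n (Fin (2 * n)), IsBlandRun a b c S → (S 0).point = x →
            ∃ k ≤ n, IsOptimal C c (S k).point := by
  obtain ⟨X, G, h⟩ := hcube.exists_isCubeLabeling
  refine ⟨le_antisymm (h.monotoneDiameter_le hC) (h.le_monotoneDiameter hC), fun c => ?_⟩
  obtain ⟨w, hw⟩ := h.exists_isOptimal hC c
  obtain ⟨p, hp⟩ := exists_facet_enumeration w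
  let E : Fin n × Bool → {G : Set (Euc n) // IsFacet C G} := fun q => ⟨G q.1 q.2, h.isFacet _ _⟩
  have hE : Function.Bijective E := by
    constructor
    · rintro ⟨i, s⟩ ⟨j, t⟩ hij
      have hG : G i s = G j t := congrArg Subtype.val hij
      -- Equal facets contain the same labeled vertices, and these determine the pair `(i, s)`.
      have key : ∀ u : Fin n → Bool, u i = s ↔ u j = t := fun u => by
        rw [← h.mem_facet_iff, hG, h.mem_facet_iff]
      have h1 := (key fun _ => s).1 rfl
      have hij : i = j := by
        by_contra hne
        have h2 := (key (flipAt (fun _ => s) j)).1 (flipAt_of_ne _ hne)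
        simp [h1] at h2
      exact Prod.ext hij h1
    · rintro ⟨H, hH⟩
      obtain ⟨i, s, rfl⟩ := h.exists_eq_facet H hH
      exact ⟨(i, s), rfl⟩
  refine ⟨p.symm.trans (Equiv.ofBijective E hE), fun a b hab x hx => ?_⟩
  have hd : IsCubeDescription C X (fun i s => a (p (i, s))) fun i s => b (p (i, s)) :=
    h.isCubeDescription (fun i s => (hab (p (i, s))).1) fun i s => by
      have := (hab (p (i, s))).2
      simpa [E] using this
  obtain ⟨v, rfl⟩ := h.exists_eq_of_mem_vertices hx
  exact ⟨hd.exists_isBlandRun c v, fun S hS hS0 => hd.blandRun_isOptimal hw hp hS hS0⟩
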